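/- Let $L$ be a finite bounded distributive lattice with at least two elements, regarded as an algebra $(L;\vee,\wedge,0,1)$. Let $ISP(L)$ be the category whose objects are the algebras isomorphic to a subalgebra of a direct power $L^I$ ($I$ any set, possibly empty), with all homomorphisms of bounded lattices. Let $PSpa$ be the category whose objects are the compact topological spaces $X$ with a partial order $\le$ such that whenever $x\not\le y$ there is a clopen up-set $W\subseteq X$ with $x\in W$ and $y\notin W$, with the continuous order-preserving maps. Then $ISP(L)$ is dually equivalent to $PSpa$, i.e. $ISP(L)^{\mathrm{op}}\simeq PSpa$. Moreover the dual equivalence is given by hom-functors into any two-element algebra $D\in ISP(L)$ (for example the subalgebra $\{0,1\}$ of $L$, or $L$ itself when $|L|=2$). Equip $D$, as an object of $PSpa$, with its order and the discrete topology. Let $\mathcal G(A)=\mathrm{Hom}_{ISP(L)}(A,D)$ with the pointwise order and the topology induced from the product space $D^A$, and let $\mathcal C(S)=\mathrm{Hom}_{PSpa}(S,D)$ with pointwise operations; both functors act on arrows by precomposition. Then the evaluation maps $\sigma_A:A\to\mathcal C\mathcal G(A)$, $\sigma_A(a)(v)=v(a)$, and $\delta_S:S\to\mathcal G\mathcal C(S)$,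 $\delta_S(s)(f)=f(s)$, are natural isomorphisms. -/

import Mathlib

open CategoryTheory

universe u

/-- `𝕀𝕊ℙ(L)`: the bounded distributive lattices isomorphic to a subalgebra (a sublattice containing
`⊥` and `⊤`) of a direct power `I → L`. The index set may be empty. An order isomorphism
between bounded lattices is the same as an isomorphism for the operations `∨, ∧, 0, 1`. -/
def MemISP (L : Type u) [DistribLattice L] [BoundedOrder L] : ObjectProperty BddDistLat.{u} :=
  fun A => ∃ (I : Type u) (S : Sublattice (I → L)),
    (⊥ : I → L) ∈ S ∧ (⊤ : I → L) ∈ S ∧ Nonempty (A ≃o S)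

/-- The category `ISP(L)`: algebras in `𝕀𝕊ℙ(L)` and all homomorphisms for `∨, ∧, 0, 1`. -/
abbrev ISP (L : Type u) [DistribLattice L] [BoundedOrder L] : Type (u + 1) :=
  (MemISP L).FullSubcategory

/-- An algebra that embeds into a power of `L` belongs to `𝕀𝕊ℙ(L)`. -/
theorem memISP_of_injective {L : Type u} [DistribLattice L] [BoundedOrder L] (A : BddDistLat.{u})
    (I : Type u) (f : BoundedLatticeHom A (I → L)) (hf : Function.Injective f) :
    MemISP L A := by
  have key : ∀ a b, f a ≤ f b ↔ a ≤ b := fun a b => by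
    rw [← inf_eq_left, ← map_inf, hf.eq_iff, inf_eq_left]
  refine ⟨I, ⟨Set.range f, ?_, ?_⟩, ⟨⊥, map_bot f⟩, ⟨⊤, map_top f⟩, ⟨?_⟩⟩
  · rintro _ ⟨a, rfl⟩ _ ⟨b, rfl⟩
    exact ⟨a ⊔ b, map_sup f a b⟩
  · rintro _ ⟨a, rfl⟩ _ ⟨b, rfl⟩
    exact ⟨a ⊓ b, map_inf f a b⟩
  · exact ⟨Equiv.ofInjective f hf, fun {a b} => key a b⟩

/-- Every algebra in `𝕀𝕊ℙ(L)` embeds into a power of `L`. -/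
theorem MemISP.exists_injective {L : Type u} [DistribLattice L] [BoundedOrder L]
    {A : BddDistLat.{u}} (hA : MemISP L A) :
    ∃ (I : Type u) (f : BoundedLatticeHom A (I → L)), Function.Injective f := by
  obtain ⟨I, S, hb, ht, ⟨e⟩⟩ := hA
  refine ⟨I, ⟨⟨⟨fun a => (e a : I → L), fun a b => ?_⟩, fun a b => ?_⟩, ?_, ?_⟩, ?_⟩
  · simp [map_sup]
  · simp [map_inf]
  · have h1 : e ⊤ = ⟨⊤, ht⟩ :=
      le_antisymm (fun _ => le_top) ((OrderIso.symm_apply_le e).1 le_top)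
    exact congrArg Subtype.val h1
  · have h0 : e ⊥ = ⟨⊥, hb⟩ :=
      le_antisymm ((OrderIso.le_symm_apply e).1 bot_le) (fun _ => bot_le)
    exact congrArg Subtype.val h0
  · exact fun a b h => e.injective (Subtype.ext h)

/-- An object of `PSpa`: a compact space with a partial order such that, whenever `¬ x ≤ y`, some
clopen up-set contains `x` but not `y`. -/
structure PSpa : Type (u + 1) where
  /-- The underlying set. -/
  carrier : Type u
  [top : TopologicalSpace carrier]
  [ord : PartialOrder carrier]
  [compact : CompactSpace carrier]
  [sep : PriestleySpace carrier]

namespace PSpa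

instance : CoeSort PSpa.{u} (Type u) := ⟨PSpa.carrier⟩

attribute [instance] PSpa.top PSpa.ord PSpa.compact PSpa.sep

/-- Arrows of `PSpa` are the continuous order-preserving maps. -/
instance : Category PSpa.{u} where
  Hom X Y := X →Co Y
  id X := ContinuousOrderHom.id X
  comp f g := ContinuousOrderHom.comp g f

instance : ConcreteCategory PSpa.{u} (fun X Y => X →Co Y) where
  hom f := f
  ofHom f := f

/-- A finite partially ordered set with the discrete topology, as an object of `PSpa`. -/
def discrete (D : Type u) [PartialOrder D] [Finite D] : PSpa.{u} :=
  letI : TopologicalSpace D := ⊥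
  haveI : DiscreteTopology D := ⟨rfl⟩
  { carrier := D
    sep := ⟨fun {x _} h => ⟨Set.Ici x, isClopen_discrete _, isUpperSet_Ici x, le_rfl, h⟩⟩ }

end PSpa

variable {L : Type u} [DistribLattice L] [BoundedOrder L]

/-- The set `HOM(A, D)` of homomorphisms, written as a type of its own to carry a topology and an
order. -/
def HomSpace (A D : ISP L) : Type u := A ⟶ D

namespace HomSpace

variable {A D : ISP L}

/-- The value `v(a)`. -/
def eval (v : HomSpace A D) (a : A.obj) : D.obj := InducedCategory.Hom.hom v a

theorem eval_injective : Function.Injective (eval : HomSpace A D → A.obj → D.obj) := by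
  intro v w h
  apply ObjectProperty.hom_ext
  ext a
  exact congrFun h a

/-- The pointwise order: `v ≤ w` iff `v(a) ≤ w(a)` for all `a`. -/
instance : PartialOrder (HomSpace A D) := PartialOrder.lift eval eval_injective

/-- The topology induced by the product topology on `A → D`, where `D` is discrete. -/
instance : TopologicalSpace (HomSpace A D) :=
  TopologicalSpace.induced eval (@Pi.topologicalSpace A.obj (fun _ => D.obj) (fun _ => ⊥))

theorem isClopen_eval (a : A.obj) (T : Set D.obj) :
    IsClopen {v : HomSpace A D | v.eval a ∈ T} := by
  letI : TopologicalSpace D.obj := ⊥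
  haveI : DiscreteTopology D.obj := ⟨rfl⟩
  have hc : Continuous fun v : HomSpace A D => v.eval a :=
    (continuous_apply a).comp continuous_induced_dom
  exact (isClopen_discrete T).preimage hc

instance : PriestleySpace (HomSpace A D) where
  priestley {v w} h := by
    have h' : ¬ ∀ a, v.eval a ≤ w.eval a := h
    push Not at h'
    obtain ⟨a, ha⟩ := h'
    exact ⟨_, isClopen_eval a (Set.Ici (v.eval a)), fun x y hxy hx => le_trans hx (hxy a),
      le_rfl, ha⟩

instance [Finite D.obj] : CompactSpace (HomSpace A D) := by
  letI : TopologicalSpace D.obj := ⊥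
  haveI : DiscreteTopology D.obj := ⟨rfl⟩
  have hemb : Topology.IsInducing (eval : HomSpace A D → A.obj → D.obj) := ⟨rfl⟩
  have hc (a : A.obj) : Continuous fun f : A.obj → D.obj => f a := continuous_apply a
  have hr : Set.range (eval : HomSpace A D → A.obj → D.obj) =
      {f | (∀ a b, f (a ⊔ b) = f a ⊔ f b) ∧ (∀ a b, f (a ⊓ b) = f a ⊓ f b) ∧
        f ⊤ = ⊤ ∧ f ⊥ = ⊥} := by
    ext f
    constructor
    · rintro ⟨v, rfl⟩
      exact ⟨map_sup (InducedCategory.Hom.hom v).hom, map_inf (InducedCategory.Hom.hom v).hom,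
        map_top (InducedCategory.Hom.hom v).hom, map_bot (InducedCategory.Hom.hom v).hom⟩
    · rintro ⟨h1, h2, h3, h4⟩
      exact ⟨ObjectProperty.homMk (BddDistLat.ofHom ⟨⟨⟨f, h1⟩, h2⟩, h3, h4⟩), rfl⟩
  have hcl : IsClosed (Set.range (eval : HomSpace A D → A.obj → D.obj)) := by
    rw [hr]
    have h2 (g : D.obj × D.obj → D.obj) : Continuous g := continuous_of_discreteTopology
    simp only [Set.ofPred_and, Set.ofPred_forall]
    refine (isClosed_iInter fun a => isClosed_iInter fun b => ?_).inter
      ((isClosed_iInter fun a => isClosed_iInter fun b => ?_).inter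
        ((isClosed_eq (hc _) continuous_const).inter (isClosed_eq (hc _) continuous_const)))
    · exact isClosed_eq (hc _) ((h2 fun p => p.1 ⊔ p.2).comp ((hc a).prodMk (hc b)))
    · exact isClosed_eq (hc _) ((h2 fun p => p.1 ⊓ p.2).comp ((hc a).prodMk (hc b)))
  exact (Topology.IsClosedEmbedding.mk ⟨hemb, eval_injective⟩ hcl).compactSpace

/-- Precomposition with a homomorphism `f : A → B`, as a map `HOM(B, D) → HOM(A, D)`. -/
def precomp {A B : ISP L} (f : A ⟶ B) : HomSpace B D →Co HomSpace A D where
  toFun v := f ≫ v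
  monotone' _ _ h a := h (InducedCategory.Hom.hom f a)
  continuous_toFun := by
    letI : TopologicalSpace D.obj := ⊥
    refine continuous_induced_rng.2 (continuous_pi fun a => ?_)
    exact (continuous_apply (InducedCategory.Hom.hom f a)).comp continuous_induced_dom

end HomSpace

/-- The contravariant functor `HOM(-, D)` from `ISP(L)` to `PSpa`, for a finite algebra `D`: an
algebra `A` goes to the ordered space `HOM(A, D)`, a homomorphism `f` to `v ↦ v ∘ f`. -/
def homFunctor (D : ISP L) [Finite D.obj] : (ISP L)ᵒᵖ ⥤ PSpa.{u} where
  obj A := { carrier := HomSpace A.unop D }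
  map f := HomSpace.precomp f.unop

/-- The set `HOM(S, D)` of arrows of `PSpa` into the discrete ordered space `D`, written as a type
of its own to carry the pointwise operations. -/
def MapAlg (S : PSpa.{u}) (D : ISP L) [Finite D.obj] : Type u := S ⟶ PSpa.discrete D.obj

namespace MapAlg

variable {S : PSpa.{u}} {D : ISP L} [Finite D.obj]

/-- The value `f(s)`. -/
def eval (f : MapAlg S D) (s : S) : D.obj := DFunLike.coe (F := S →Co PSpa.discrete D.obj) f s

theorem eval_injective : Function.Injective (eval : MapAlg S D → S → D.obj) := by
  intro f g h
  exact ContinuousOrderHom.ext fun s => congrFun h s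

/-- The element of `HOM(S, D)` with the given values. -/
def mk (f : S → D.obj) (hf : Monotone f) (hc : ∀ T : Set D.obj, IsOpen (f ⁻¹' T)) : MapAlg S D :=
  letI : TopologicalSpace D.obj := ⊥
  (⟨⟨f, hf⟩, ⟨fun T _ => hc T⟩⟩ : S →Co D.obj)

theorem monotone_eval (f : MapAlg S D) : Monotone f.eval :=
  OrderHom.monotone' (ContinuousOrderHom.toOrderHom (β := PSpa.discrete D.obj) f)

theorem isOpen_preimage (f : MapAlg S D) (T : Set D.obj) : IsOpen (f.eval ⁻¹' T) := by
  let _ : TopologicalSpace D.obj := ⊥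
  have _ : DiscreteTopology D.obj := ⟨rfl⟩
  exact (isOpen_discrete T).preimage (ContinuousOrderHom.continuous_toFun (β := PSpa.discrete D.obj) f)

theorem isOpen_preimage₂ (f g : MapAlg S D) (m : D.obj → D.obj → D.obj) (T : Set D.obj) :
    IsOpen ((fun s => m (f.eval s) (g.eval s)) ⁻¹' T) := by
  have h : (fun s => m (f.eval s) (g.eval s)) ⁻¹' T =
      ⋃ p : {p : D.obj × D.obj // m p.1 p.2 ∈ T}, f.eval ⁻¹' {p.1.1} ∩ g.eval ⁻¹' {p.1.2} := by
    ext s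
    simp
  rw [h]
  exact isOpen_iUnion fun p => (f.isOpen_preimage _).inter (g.isOpen_preimage _)

/-- The operations `∨, ∧, 0, 1` and the order on `HOM(S, D)` are pointwise. -/
instance : Max (MapAlg S D) where
  max f g := mk (fun s => f.eval s ⊔ g.eval s) (f.monotone_eval.sup g.monotone_eval)
    (isOpen_preimage₂ f g (· ⊔ ·))

instance : Min (MapAlg S D) where
  min f g := mk (fun s => f.eval s ⊓ g.eval s) (f.monotone_eval.inf g.monotone_eval)
    (isOpen_preimage₂ f g (· ⊓ ·))

instance : PartialOrder (MapAlg S D) := PartialOrder.lift eval eval_injective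

instance : DistribLattice (MapAlg S D) :=
  eval_injective.distribLattice eval Iff.rfl Iff.rfl (fun _ _ => rfl) (fun _ _ => rfl)

instance : BoundedOrder (MapAlg S D) where
  top := mk (fun _ => ⊤) (fun _ _ _ => le_rfl) (fun _ => isOpen_const)
  bot := mk (fun _ => ⊥) (fun _ _ _ => le_rfl) (fun _ => isOpen_const)
  le_top _ _ := le_top
  bot_le _ _ := bot_le

theorem memISP (S : PSpa.{u}) (D : ISP L) [Finite D.obj] :
    MemISP L (BddDistLat.of (MapAlg S D)) := by
  obtain ⟨I, f, hf⟩ := D.property.exists_injective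
  refine memISP_of_injective _ (S × I)
    ⟨⟨⟨fun φ p => f (φ.eval p.1) p.2, fun φ ψ => ?_⟩, fun φ ψ => ?_⟩, ?_, ?_⟩ ?_
  · funext p
    exact congrFun (map_sup f _ _) p.2
  · funext p
    exact congrFun (map_inf f _ _) p.2
  · funext p
    exact congrFun (map_top f) p.2
  · funext p
    exact congrFun (map_bot f) p.2
  · intro φ ψ h
    refine eval_injective (funext fun s => hf (funext fun i => ?_))
    exact congrFun h (s, i)

/-- Precomposition with an arrow `g : S → T`, as a homomorphism `HOM(T, D) → HOM(S, D)`. -/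
def precomp {S T : PSpa.{u}} (g : S ⟶ T) : BoundedLatticeHom (MapAlg T D) (MapAlg S D) where
  toFun f := g ≫ f
  map_sup' _ _ := rfl
  map_inf' _ _ := rfl
  map_top' := rfl
  map_bot' := rfl

end MapAlg

/-- The contravariant functor `HOM(-, D)` from `PSpa` to `ISP(L)`, for a finite algebra `D`: a
space `S` goes to the algebra `HOM(S, D)`, an arrow `g` to `f ↦ f ∘ g`. -/
def mapFunctor (D : ISP L) [Finite D.obj] : PSpa.{u}ᵒᵖ ⥤ ISP L where
  obj S := ⟨BddDistLat.of (MapAlg S.unop D), MapAlg.memISP S.unop D⟩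
  map g := ObjectProperty.homMk (BddDistLat.ofHom (MapAlg.precomp g.unop))

/-- The evaluation homomorphism `A → HOM(HOM(A, D), D)`, `a ↦ (v ↦ v(a))`. -/
def evalAlg (D : ISP L) [Finite D.obj] (A : ISP L) :
    A ⟶ (mapFunctor D).obj (.op ((homFunctor D).obj (.op A))) :=
  ObjectProperty.homMk (BddDistLat.ofHom
    (X := A.obj) (Y := MapAlg ((homFunctor D).obj (.op A)) D)
    { toFun a := MapAlg.mk (S := (homFunctor D).obj (.op A)) (fun v => HomSpace.eval v a)
        (fun _ _ h => h a) (fun T => (HomSpace.isClopen_eval a T).isOpen)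
      map_sup' a b := MapAlg.eval_injective
        (funext fun v => map_sup (InducedCategory.Hom.hom v).hom a b)
      map_inf' a b := MapAlg.eval_injective
        (funext fun v => map_inf (InducedCategory.Hom.hom v).hom a b)
      map_top' := MapAlg.eval_injective (funext fun v => map_top (InducedCategory.Hom.hom v).hom)
      map_bot' := MapAlg.eval_injective (funext fun v => map_bot (InducedCategory.Hom.hom v).hom) })

/-- The evaluation arrow `S → HOM(HOM(S, D), D)`, `s ↦ (f ↦ f(s))`. -/
def evalSpace (D : ISP L) [Finite D.obj] (S : PSpa.{u}) :
    S ⟶ (homFunctor D).obj (.op ((mapFunctor D).obj (.op S))) :=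
  ({ toFun s := (ObjectProperty.homMk (BddDistLat.ofHom (X := MapAlg S D) (Y := D.obj)
        { toFun f := f.eval s
          map_sup' _ _ := rfl
          map_inf' _ _ := rfl
          map_top' := rfl
          map_bot' := rfl }) : (mapFunctor D).obj (.op S) ⟶ D)
     monotone' _ _ h f := MapAlg.monotone_eval (S := S) (D := D) f h
     continuous_toFun := by
       let _ : TopologicalSpace D.obj := ⊥
       refine continuous_induced_rng.2 (continuous_pi fun f => ?_)
       exact ContinuousOrderHom.continuous_toFun (β := PSpa.discrete D.obj) f } :
    S →Co HomSpace ((mapFunctor D).obj (.op S)) D)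

/-! This is Priestley duality. Every algebra in `ISP L` is a bounded distributive lattice, and a
two-element `D` is `{⊥, ⊤}`, so homomorphisms into `D` amount to prime ideals and arrows into `D` to
clopen up-sets. Each evaluation map then needs a separation argument and a compactness argument. For
algebras, the prime ideal theorem makes evaluation injective. It is surjective because compactness
of `HomSpace A D` forces every clopen up-set to be `{v | v.eval a = ⊤}` for a single `a`
(`HomSpace.exists_eq_setOf_eval_eq_top`). For spaces, the separation axiom of `PSpa` makes
evaluation an order embedding. It is surjective because compactness of `S` yields a point realising
any given homomorphism (`MapAlg.exists_eval_eq`). -/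

/-! ### Two-element lattices and prime ideals. -/

theorem eq_bot_or_eq_top_of_card_eq_two {D : Type*} [PartialOrder D] [BoundedOrder D]
    (hD : Nat.card D = 2) (x : D) : x = ⊥ ∨ x = ⊤ := by
  obtain ⟨a, b, hab, huniv⟩ := Nat.card_eq_two_iff.1 hD
  have h (y : D) : y = a ∨ y = b := by
    have : y ∈ ({a, b} : Set D) := huniv ▸ Set.mem_univ y
    simpa using this
  have hne : (⊥ : D) ≠ ⊤ := fun e =>
    hab (le_antisymm (le_top.trans (e ▸ bot_le)) (le_top.trans (e ▸ bot_le)))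
  rcases h x with h1 | h1 <;> rcases h ⊥ with h2 | h2 <;> rcases h ⊤ with h3 | h3 <;> simp_all

theorem bot_ne_top_of_card_eq_two {D : Type*} [PartialOrder D] [BoundedOrder D]
    (hD : Nat.card D = 2) : (⊥ : D) ≠ ⊤ := by
  intro e
  have := subsingleton_of_bot_eq_top e
  have : Nat.card D = 1 := Nat.card_unique
  omega

open Classical in
/-- The homomorphism to a bounded lattice that is `⊥` on a prime ideal and `⊤` off it. -/
noncomputable def Order.Ideal.IsPrime.toHom {A : Type*} [DistribLattice A] [BoundedOrder A]
    {J : Order.Ideal A} (hJ : J.IsPrime) (D : Type*) [DistribLattice D] [BoundedOrder D] :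
    BoundedLatticeHom A D where
  toFun a := if a ∈ J then ⊥ else ⊤
  map_sup' a b := by
    by_cases ha : a ∈ J <;> by_cases hb : b ∈ J <;> simp [Order.Ideal.sup_mem_iff, ha, hb]
  map_inf' a b := by
    have h : a ⊓ b ∈ J ↔ a ∈ J ∨ b ∈ J :=
      ⟨hJ.mem_or_mem, fun h => h.elim (J.lower inf_le_left) (J.lower inf_le_right)⟩
    by_cases ha : a ∈ J <;> by_cases hb : b ∈ J <;> simp [h, ha, hb]
  map_top' := if_neg hJ.toIsProper.top_notMem
  map_bot' := if_pos J.bot_mem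

/-- Since `¬ a ≤ b`, the filter above `a` is disjoint from the ideal below `b`; a prime ideal
separating them gives `v`. -/
theorem exists_boundedLatticeHom_of_not_le {A : Type*} [DistribLattice A] [BoundedOrder A]
    (D : Type*) [DistribLattice D] [BoundedOrder D] {a b : A} (h : ¬ a ≤ b) :
    ∃ v : BoundedLatticeHom A D, v a = ⊤ ∧ v b = ⊥ := by
  obtain ⟨J, hJ, hb, ha⟩ := DistribLattice.prime_ideal_of_disjoint_filter_ideal
    (F := Order.PFilter.principal a) (I := Order.Ideal.principal b)
    (Set.disjoint_left.2 fun x hx hx' => h ((Order.PFilter.mem_principal.1 hx).trans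
      (Order.Ideal.mem_principal.1 hx')))
  refine ⟨hJ.toHom D, if_neg fun h' => ?_, if_pos (hb (Order.Ideal.mem_principal.2 le_rfl))⟩
  exact Set.disjoint_left.1 ha (Order.PFilter.mem_principal.2 le_rfl) h'

/-! ### Recognising isomorphisms in the two categories. -/

namespace ISP

theorem isIso_of_bijective {A B : ISP L} (f : A ⟶ B)
    (hf : Function.Bijective (InducedCategory.Hom.hom f)) : IsIso f := by
  let g : BoundedLatticeHom A.obj B.obj := (InducedCategory.Hom.hom f).hom
  let e : A.obj ≃o B.obj :=
    { Equiv.ofBijective g hf with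
      map_rel_iff' {a b} := by
        change g a ≤ g b ↔ a ≤ b
        rw [← inf_eq_left, ← map_inf, hf.injective.eq_iff, inf_eq_left] }
  let i : A ≅ B := (MemISP L).isoMk (BddDistLat.Iso.mk e)
  have : f = i.hom := by
    apply ObjectProperty.hom_ext
    ext a
    rfl
  rw [this]
  infer_instance

end ISP

namespace PSpa

/-- Reflecting the order gives injectivity and a monotone inverse; that inverse is continuous
because `S` is compact and `T` is Hausdorff. -/
theorem isIso_of_surjective {S T : PSpa.{u}} (f : S →Co T) (hf : Function.Surjective f)
    (hle : ∀ s t, f s ≤ f t → s ≤ t) : IsIso (C := PSpa.{u}) (X := S) (Y := T) f := by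
  have hinj : Function.Injective f := fun s t h => le_antisymm (hle s t h.le) (hle t s h.ge)
  let e : S ≃ T := Equiv.ofBijective f ⟨hinj, hf⟩
  have he : Continuous e := f.continuous_toFun
  let g : T →Co S :=
    { toFun := e.symm
      monotone' := fun x y hxy => hle _ _ (by
        change e (e.symm x) ≤ e (e.symm y)
        simpa using hxy)
      continuous_toFun := he.continuous_symm_of_equiv_compact_to_t2 }
  refine ⟨g, ?_, ?_⟩
  · exact ContinuousOrderHom.ext fun s => e.symm_apply_apply s
  · exact ContinuousOrderHom.ext fun t => e.apply_symm_apply t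

end PSpa

/-! ### Separation and clopen up-sets in the dual space. -/

namespace HomSpace

variable {A D : ISP L}

theorem eval_sup (v : HomSpace A D) (a b : A.obj) : v.eval (a ⊔ b) = v.eval a ⊔ v.eval b :=
  map_sup (InducedCategory.Hom.hom v).hom a b

theorem eval_inf (v : HomSpace A D) (a b : A.obj) : v.eval (a ⊓ b) = v.eval a ⊓ v.eval b :=
  map_inf (InducedCategory.Hom.hom v).hom a b

theorem eval_top (v : HomSpace A D) : v.eval ⊤ = ⊤ := map_top (InducedCategory.Hom.hom v).hom

theorem eval_bot (v : HomSpace A D) : v.eval ⊥ = ⊥ := map_bot (InducedCategory.Hom.hom v).hom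

theorem exists_eval_of_not_le (D : ISP L) {a b : A.obj} (h : ¬ a ≤ b) :
    ∃ v : HomSpace A D, v.eval a = ⊤ ∧ v.eval b = ⊥ := by
  obtain ⟨v, hv⟩ := exists_boundedLatticeHom_of_not_le D.obj h
  exact ⟨ObjectProperty.homMk (BddDistLat.ofHom v), hv⟩

theorem exists_eval_of_not_ge (hD : Nat.card D.obj = 2) {v w : HomSpace A D} (h : ¬ v ≤ w) :
    ∃ a, v.eval a = ⊤ ∧ w.eval a = ⊥ := by
  have h' : ¬ ∀ a, v.eval a ≤ w.eval a := h
  push Not at h'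
  obtain ⟨a, ha⟩ := h'
  refine ⟨a, (eq_bot_or_eq_top_of_card_eq_two hD _).resolve_left fun e => ha (e ▸ bot_le),
    (eq_bot_or_eq_top_of_card_eq_two hD _).resolve_right fun e => ha (e ▸ le_top)⟩

/-- The clopen up-sets of `HOM(A, D)` are the sets `{v | v(a) = 1}`. -/
theorem exists_eq_setOf_eval_eq_top [Finite D.obj] (hD : Nat.card D.obj = 2)
    {U : Set (HomSpace A D)} (hU : IsClopen U) (hup : IsUpperSet U) :
    ∃ a : A.obj, U = {v | v.eval a = ⊤} := by
  have hne := bot_ne_top_of_card_eq_two hD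
  have h1 : ∀ v ∈ U, ∃ a : A.obj, v.eval a = ⊤ ∧ {w : HomSpace A D | w.eval a = ⊤} ⊆ U := by
    intro v hv
    have : Nonempty {a : A.obj // v.eval a = ⊤} := ⟨⟨⊤, v.eval_top⟩⟩
    -- Any `w` outside `U` is not above `v`, so some `a` has `v.eval a = ⊤` and `w.eval a = ⊥`.
    -- These `a` are closed under `⊓`, so the cover of `Uᶜ` is directed and one `a` suffices.
    obtain ⟨⟨a, ha⟩, haU⟩ := hU.compl.isClosed.isCompact.elim_directed_cover
      (fun a : {a : A.obj // v.eval a = ⊤} => {w : HomSpace A D | w.eval a.1 ∈ ({⊤}ᶜ : Set D.obj)})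
      (fun a => (isClopen_eval a.1 _).isOpen)
      (fun w hw => by
        obtain ⟨a, ha, hwa⟩ := exists_eval_of_not_ge hD fun hle => hw (hup hle hv)
        exact Set.mem_iUnion.2 ⟨⟨a, ha⟩, fun e => hne (hwa.symm.trans e)⟩)
      (fun a b => ⟨⟨a.1 ⊓ b.1, by rw [eval_inf, a.2, b.2, inf_top_eq]⟩,
        fun w hw e => hw (top_le_iff.1 ((Set.mem_singleton_iff.1 e).ge.trans
          (w.eval_inf a.1 b.1 ▸ inf_le_left))),
        fun w hw e => hw (top_le_iff.1 ((Set.mem_singleton_iff.1 e).ge.trans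
          (w.eval_inf a.1 b.1 ▸ inf_le_right)))⟩)
    refine ⟨a, ha, fun w hw => ?_⟩
    by_contra hwU
    exact haU hwU hw
  -- Dually, the sets `{w | w.eval a = ⊤}` inside `U` cover `U` and are directed under `⊔`: with two
  -- values, a join is `⊤` only if one of its terms is.
  obtain ⟨⟨a, haU⟩, ha⟩ := hU.isClosed.isCompact.elim_directed_cover
      (ι := {a : A.obj // {w : HomSpace A D | w.eval a = ⊤} ⊆ U})
      (hι := ⟨⟨⊥, fun w hw => (hne (w.eval_bot.symm.trans hw)).elim⟩⟩)
      (fun a => {w : HomSpace A D | w.eval a.1 ∈ ({⊤} : Set D.obj)})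
      (fun a => (isClopen_eval a.1 _).isOpen)
      (fun v hv => by
        obtain ⟨a, hva, haU⟩ := h1 v hv
        exact Set.mem_iUnion.2 ⟨⟨a, haU⟩, hva⟩)
      (fun a b => ⟨⟨a.1 ⊔ b.1, fun w hw => by
          by_contra hwU
          have hwa := (eq_bot_or_eq_top_of_card_eq_two hD (w.eval a.1)).resolve_right
            fun e => hwU (a.2 e)
          have hwb := (eq_bot_or_eq_top_of_card_eq_two hD (w.eval b.1)).resolve_right
            fun e => hwU (b.2 e)
          have hw' : w.eval (a.1 ⊔ b.1) = ⊤ := hw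
          rw [eval_sup, hwa, hwb, sup_bot_eq] at hw'
          exact hne hw'⟩,
        fun w hw => top_le_iff.1 ((Set.mem_singleton_iff.1 hw).ge.trans
          (w.eval_sup a.1 b.1 ▸ le_sup_left)),
        fun w hw => top_le_iff.1 ((Set.mem_singleton_iff.1 hw).ge.trans
          (w.eval_sup a.1 b.1 ▸ le_sup_right))⟩)
  exact ⟨a, ha.antisymm haU⟩

end HomSpace

/-! ### Separation and homomorphisms on the algebra of maps. -/

namespace MapAlg

variable {S : PSpa.{u}} {D : ISP L} [Finite D.obj]

theorem isClopen_preimage (f : MapAlg S D) (T : Set D.obj) : IsClopen (f.eval ⁻¹' T) :=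
  ⟨⟨f.isOpen_preimage Tᶜ⟩, f.isOpen_preimage T⟩

/-- The indicator of a separating clopen up-set is monotone and locally constant. -/
theorem exists_eval_of_not_le (D : ISP L) [Finite D.obj] {s t : S} (h : ¬ s ≤ t) :
    ∃ f : MapAlg S D, f.eval s = ⊤ ∧ f.eval t = ⊥ := by
  classical
  obtain ⟨W, hW, hup, hs, ht⟩ := exists_isClopen_upper_of_not_le h
  refine ⟨mk (fun x => if x ∈ W then ⊤ else ⊥) (fun x y hxy => ?_) (fun T => ?_),
    if_pos hs, if_neg ht⟩
  · by_cases hx : x ∈ W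
    · simp [hx, hup hxy hx]
    · simp [hx]
  · have hcont : IsLocallyConstant fun x : S => if x ∈ W then (⊤ : D.obj) else ⊥ := by
      refine (IsLocallyConstant.iff_exists_open _).2 fun x => ?_
      by_cases hx : x ∈ W
      · exact ⟨W, hW.isOpen, hx, fun y hy => by simp [hx, hy]⟩
      · exact ⟨Wᶜ, hW.compl.isOpen, hx, fun y hy => by simp [hx, Set.notMem_of_mem_compl hy]⟩
    exact hcont T

/-- Every homomorphism `HOM(S, D) → D` is the evaluation at a point of `S`. -/
theorem exists_eval_eq (hD : Nat.card D.obj = 2) (v : BoundedLatticeHom (MapAlg S D) D.obj) :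
    ∃ s : S, ∀ f : MapAlg S D, f.eval s = v f := by
  have hne := bot_ne_top_of_card_eq_two hD
  -- A point realising `v` must lie in every `K p`. Each `K p` is nonempty, since `p.1.1 ≤ p.1.2`
  -- would give `⊤ ≤ ⊥` under `v`; meeting first and joining second components makes the family
  -- directed.
  let K (p : {p : MapAlg S D × MapAlg S D // v p.1 = ⊤ ∧ v p.2 = ⊥}) : Set S :=
    {s | ¬ p.1.1.eval s ≤ p.1.2.eval s}
  have hK (p) : IsClosed (K p) :=
    ⟨by
      have : (K p)ᶜ = ⋃ q : {q : D.obj × D.obj // q.1 ≤ q.2},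
          p.1.1.eval ⁻¹' {q.1.1} ∩ p.1.2.eval ⁻¹' {q.1.2} := by
        ext s
        simp [K]
      rw [this]
      exact isOpen_iUnion fun q => (isOpen_preimage _ _).inter (isOpen_preimage _ _)⟩
  obtain ⟨s, hs⟩ := IsCompact.nonempty_iInter_of_directed_nonempty_isCompact_isClosed
    (hι := ⟨⟨(⊤, ⊥), map_top v, map_bot v⟩⟩) K
    (fun p q => ⟨⟨(p.1.1 ⊓ q.1.1, p.1.2 ⊔ q.1.2), by simp [p.2.1, q.2.1], by simp [p.2.2, q.2.2]⟩,
      fun s hs h => hs (inf_le_left.trans (h.trans le_sup_left)),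
      fun s hs h => hs (inf_le_right.trans (h.trans le_sup_right))⟩)
    (fun p => by
      by_contra hemp
      have hle : p.1.1 ≤ p.1.2 := fun s => by
        by_contra h
        exact hemp ⟨s, h⟩
      have := OrderHomClass.mono v hle
      rw [p.2.1, p.2.2] at this
      exact hne (le_antisymm bot_le this))
    (fun p => (hK p).isCompact) hK
  rw [Set.mem_iInter] at hs
  refine ⟨s, fun f => ?_⟩
  -- The pairs `(⊤, f)` and `(f, ⊥)` determine `f.eval s` in the two cases.
  rcases eq_bot_or_eq_top_of_card_eq_two hD (v f) with h | h
  · rw [h]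
    exact (eq_bot_or_eq_top_of_card_eq_two hD _).resolve_right
      fun e => hs ⟨(⊤, f), map_top v, h⟩ (le_top.trans e.ge)
  · rw [h]
    exact (eq_bot_or_eq_top_of_card_eq_two hD _).resolve_left
      fun e => hs ⟨(f, ⊥), h, map_bot v⟩ (e.le.trans bot_le)

end MapAlg

/-! ### The evaluation isomorphisms and the dual equivalence. -/

theorem isIso_evalAlg (D : ISP L) [Finite D.obj] (hD : Nat.card D.obj = 2) (A : ISP L) :
    IsIso (evalAlg D A) := by
  have hne := bot_ne_top_of_card_eq_two hD
  refine ISP.isIso_of_bijective _ ⟨fun a b h => ?_, fun φ => ?_⟩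
  · have key (v : HomSpace A D) : v.eval a = v.eval b :=
      congrFun (congrArg (MapAlg.eval (S := (homFunctor D).obj (.op A)) (D := D)) h) v
    by_contra hab
    rcases not_and_or.1 fun h : a ≤ b ∧ b ≤ a => hab (le_antisymm h.1 h.2) with h | h
    · obtain ⟨v, hva, hvb⟩ := HomSpace.exists_eval_of_not_le D h
      exact hne (hvb.symm.trans ((key v).symm.trans hva))
    · obtain ⟨v, hvb, hva⟩ := HomSpace.exists_eval_of_not_le D h
      exact hne (hva.symm.trans ((key v).trans hvb))
  · let ψ : MapAlg ((homFunctor D).obj (.op A)) D := φ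
    obtain ⟨a, ha⟩ := HomSpace.exists_eq_setOf_eval_eq_top (A := A) hD
      (U := ψ.eval ⁻¹' {⊤}) (ψ.isClopen_preimage {⊤})
      (fun v w hvw hv => top_le_iff.1 ((Set.mem_singleton_iff.1 hv).ge.trans
        (ψ.monotone_eval hvw)))
    refine ⟨a, MapAlg.eval_injective (funext fun (v : HomSpace A D) => ?_)⟩
    change v.eval a = ψ.eval v
    have hv : ψ.eval v = ⊤ ↔ v.eval a = ⊤ := Set.ext_iff.1 ha v
    rcases eq_bot_or_eq_top_of_card_eq_two hD (v.eval a) with h | h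
    · rw [h]
      exact ((eq_bot_or_eq_top_of_card_eq_two hD _).resolve_right
        fun e => hne (h.symm.trans (hv.1 e))).symm
    · rw [h, hv.2 h]

theorem isIso_evalSpace (D : ISP L) [Finite D.obj] (hD : Nat.card D.obj = 2) (S : PSpa.{u}) :
    IsIso (evalSpace D S) := by
  refine PSpa.isIso_of_surjective _ (fun v => ?_) (fun s t h => ?_)
  · obtain ⟨s, hs⟩ := MapAlg.exists_eval_eq hD (InducedCategory.Hom.hom v).hom
    exact ⟨s, HomSpace.eval_injective (funext hs)⟩
  · by_contra hst
    obtain ⟨f, hs, ht⟩ := MapAlg.exists_eval_of_not_le D hst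
    have hf : f.eval s ≤ f.eval t := h f
    rw [hs, ht] at hf
    exact bot_ne_top_of_card_eq_two hD (le_antisymm bot_le hf)

/-- The evaluation maps `A → HOM(HOM(A, D), D)` as a natural transformation. -/
def evalAlgNatTrans (D : ISP L) [Finite D.obj] :
    𝟭 (ISP L) ⟶ (homFunctor D).rightOp ⋙ mapFunctor D where
  app := evalAlg D
  naturality _ _ _ := rfl

/-- The evaluation maps `S → HOM(HOM(S, D), D)` as a natural transformation. -/
def evalSpaceNatTrans (D : ISP L) [Finite D.obj] :
    𝟭 PSpa.{u} ⟶ (mapFunctor D).rightOp ⋙ homFunctor D where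
  app := evalSpace D
  naturality _ _ _ := rfl

/-- For a two-element algebra `D`, evaluation is a natural isomorphism on `ISP(L)`. -/
noncomputable def evalAlgNatIso (D : ISP L) [Finite D.obj] (hD : Nat.card D.obj = 2) :
    𝟭 (ISP L) ≅ (homFunctor D).rightOp ⋙ mapFunctor D :=
  have (A : ISP L) : IsIso ((evalAlgNatTrans D).app A) := isIso_evalAlg D hD A
  have := NatIso.isIso_of_isIso_app (evalAlgNatTrans D)
  asIso (evalAlgNatTrans D)

/-- For a two-element algebra `D`, evaluation is a natural isomorphism on `PSpa`. -/
noncomputable def evalSpaceNatIso (D : ISP L) [Finite D.obj] (hD : Nat.card D.obj = 2) :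
    𝟭 PSpa.{u} ≅ (mapFunctor D).rightOp ⋙ homFunctor D :=
  have (S : PSpa.{u}) : IsIso ((evalSpaceNatTrans D).app S) := isIso_evalSpace D hD S
  have := NatIso.isIso_of_isIso_app (evalSpaceNatTrans D)
  asIso (evalSpaceNatTrans D)

/-- The dual equivalence between `ISP(L)` and `PSpa` given by a two-element algebra `D`. -/
noncomputable def homEquivalence (D : ISP L) [Finite D.obj] (hD : Nat.card D.obj = 2) :
    (ISP L)ᵒᵖ ≌ PSpa.{u} :=
  .mk (homFunctor D) (mapFunctor D).rightOp
    -- Passing to the opposite category reverses arrows, so the unit is built from the inverses of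
    -- the evaluations.
    (NatIso.ofComponents (fun A => ((evalAlgNatIso D hD).app A.unop).symm.op)
      (fun f => Quiver.Hom.unop_inj (by
        simp only [unop_comp]
        exact ((evalAlgNatIso D hD).inv.naturality f.unop).symm)))
    (evalSpaceNatIso D hD).symm

theorem memISP_uLift_bool (L : Type u) [DistribLattice L] [BoundedOrder L] [Nontrivial L] :
    MemISP L (BddDistLat.of (ULift.{u} Bool)) := by
  refine memISP_of_injective _ PUnit
    { toFun x _ := bif x.down then ⊤ else ⊥
      map_sup' := by rintro ⟨_ | _⟩ ⟨_ | _⟩ <;> ext <;> simp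
      map_inf' := by rintro ⟨_ | _⟩ ⟨_ | _⟩ <;> ext <;> simp
      map_top' := rfl
      map_bot' := rfl } ?_
  rintro ⟨_ | _⟩ ⟨_ | _⟩ h
  · rfl
  · exact (bot_ne_top (congrFun h PUnit.unit)).elim
  · exact (top_ne_bot (congrFun h PUnit.unit)).elim
  · rfl

theorem theoremD12 (L : Type u) [DistribLattice L] [BoundedOrder L] [Finite L] [Nontrivial L] :
    Nonempty ((ISP L)ᵒᵖ ≌ PSpa.{u}) ∧
    ∀ (D : ISP L) [Finite D.obj], Nat.card D.obj = 2 →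
      ∃ (σ : 𝟭 (ISP L) ≅ (homFunctor D).rightOp ⋙ mapFunctor D)
        (δ : 𝟭 PSpa.{u} ≅ (mapFunctor D).rightOp ⋙ homFunctor D),
        (∀ A : ISP L, σ.hom.app A = evalAlg D A) ∧
        (∀ S : PSpa.{u}, δ.hom.app S = evalSpace D S) := by
  refine ⟨?_, fun D _ hD => ⟨evalAlgNatIso D hD, evalSpaceNatIso D hD, fun _ => rfl, fun _ => rfl⟩⟩
  -- A copy of `{⊥, ⊤}` in universe `u`, in `ISP L` because `⊥ ≠ ⊤` in `L`.
  let D : ISP L := ⟨BddDistLat.of (ULift.{u} Bool), memISP_uLift_bool L⟩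
  have : Finite D.obj := inferInstanceAs (Finite (ULift.{u} Bool))
  refine ⟨homEquivalence D ?_⟩
  change Nat.card (ULift.{u} Bool) = 2
  simp
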